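/- Let $\mathcal H_S$ be a two-dimensional complex Hilbert space (the system) and $\mathcal H_A$ a complex Hilbert space of arbitrary dimension (the apparatus). Let $Q$ be an orthogonal projection on $\mathcal H_S$ with unit eigenvectors $|q_0\rangle,|q_1\rangle$ such that $Q|q_1\rangle=|q_1\rangle$ and $Q|q_0\rangle=0$. Let $H_S$ be a self-adjoint operator on $\mathcal H_S$, let $H_A$ be a (possibly unbounded) self-adjoint operator on $\mathcal H_A$, and let $V$ be a (possibly unbounded) symmetric operator on $\mathcal H_S\otimes\mathcal H_A$ whose domain $D(V)$ is mapped into itself by $H_S\otimes\mathbf 1_A$, so that the commutator $[V,H_S\otimes\mathbf 1_A]$ is defined on $D(V)$. Assume that the sum $H_S\otimes\mathbf 1_A+\mathbf 1_S\otimes H_A+V$, defined on $D(\mathbf 1_S\otimes H_A)\cap D(V)$, is essentially self-adjoint, and let $H$ be its self-adjoint closure. (For bounded self-adjoint $H_A$ and $V$ all these conditions on domains hold automatically.) Let $\hbar>0$, $\tau\ge 0$, $U(\tau)=\exp(-iH\tau/\hbar)$, let $|\Omega\rangle\in\mathcal H_A$ be a unit vector, and for $j=0,1$ let $$\rho^A_j(\tau)=\operatorname{tr}_{\mathcal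 H_S}\bigl(U(\tau)\,(|q_j\rangle\langle q_j|\otimes|\Omega\rangle\langle\Omega|)\,U(\tau)^*\bigr)$$ be the final states of the apparatus. Let $Z$ be any orthogonal projection on $\mathcal H_A$ (the pointer observable), put $p(1|j)=\operatorname{tr}(\rho^A_j(\tau)Z)$ and $p(0|j)=\operatorname{tr}(\rho^A_j(\tau)(\mathbf 1_A-Z))$ for $j=0,1$, and $$P_{error}=\tfrac12\bigl(p(1|0)+p(0|1)\bigr).$$ Then $$\Vert[Q,H_S]\Vert\le 2\Vert H_S\Vert\sqrt{P_{error}-P_{error}^2}+\frac{\tau}{\hbar}\,\Vert[V,H_S\otimes\mathbf 1_A]\Vert .$$ Here $\Vert A\Vert=\sup_{\phi\ne0}\Vert A\phi\Vert/\Vert\phi\Vert\in[0,\infty]$ is the operator norm, the supremum being over the domain of $A$, and $0\cdot\infty=0$. -/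

import Mathlib

open scoped TensorProduct InnerProductSpace ENNReal

noncomputable section

namespace QMeasure

section Tensor

variable {E F : Type*} [NormedAddCommGroup E] [InnerProductSpace ℂ E]
  [NormedAddCommGroup F] [InnerProductSpace ℂ F]

/-- The partial inner product `⟨e| ⊗ 1 : E ⊗ F → F`, i.e. `u ⊗ f ↦ ⟪e, u⟫ f`. -/
def braL (F : Type*) [NormedAddCommGroup F] [InnerProductSpace ℂ F] (e : E) :
    E ⊗[ℂ] F →L[ℂ] F :=
  (TensorProduct.lidIsometry ℂ F).toContinuousLinearEquiv.toContinuousLinearMap ∘L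
    (innerSL ℂ e).rTensor F

@[simp] theorem braL_tmul (e u : E) (f : F) : braL F e (u ⊗ₜ[ℂ] f) = ⟪e, u⟫_ℂ • f := by
  simp [braL]

/-- If `E` is finite dimensional and `F` is a Hilbert space, the algebraic tensor product
`E ⊗ F` is already complete, so that it is the Hilbert space tensor product. -/
instance instCompleteSpaceTensor [FiniteDimensional ℂ E] [CompleteSpace F] :
    CompleteSpace (E ⊗[ℂ] F) := by
  let b := stdOrthonormalBasis ℂ E
  let f : E ⊗[ℂ] F →L[ℂ] (Fin (Module.finrank ℂ E) → F) :=
    ContinuousLinearMap.pi fun i => braL F (b i)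
  let g : (Fin (Module.finrank ℂ E) → F) →L[ℂ] E ⊗[ℂ] F :=
    ∑ i, (TensorProduct.mkL ℂ E F (b i)) ∘L ContinuousLinearMap.proj i
  have hgf : ∀ x, g (f x) = x := by
    intro x
    induction x with
    | zero => simp
    | add x y hx hy => rw [map_add, map_add, hx, hy]
    | tmul u v =>
      simp only [f, g, sum_apply, ContinuousLinearMap.comp_apply,
        ContinuousLinearMap.proj_apply, ContinuousLinearMap.pi_apply, braL_tmul,
        TensorProduct.mkL_apply_apply, TensorProduct.tmul_smul]
      conv_rhs => rw [← b.sum_repr' u, TensorProduct.sum_tmul]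
      simp [TensorProduct.smul_tmul']
  have hfg : ∀ x, f (g x) = x := by
    intro x
    ext i
    simp only [f, g, sum_apply, ContinuousLinearMap.comp_apply,
      ContinuousLinearMap.proj_apply, ContinuousLinearMap.pi_apply,
      TensorProduct.mkL_apply_apply, map_sum, braL_tmul]
    simp [b.inner_eq_ite]
  let e : (E ⊗[ℂ] F) ≃L[ℂ] (Fin (Module.finrank ℂ E) → F) :=
    ContinuousLinearEquiv.equivOfInverse f g hgf hfg
  exact (completeSpace_congr (e := e.toEquiv) e.isUniformEmbedding).2 inferInstance

/-- The operator `1 ⊗ A` on `E ⊗ F` for a possibly unbounded operator `A` on `F`. Its domain is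
`E ⊗ D(A)`, and it maps `e ⊗ f` to `e ⊗ A f`. -/
def idTensor (E : Type*) [NormedAddCommGroup E] [InnerProductSpace ℂ E] (A : F →ₗ.[ℂ] F) :
    (E ⊗[ℂ] F) →ₗ.[ℂ] (E ⊗[ℂ] F) where
  domain := LinearMap.range (A.domain.subtype.lTensor E)
  toFun := (A.toFun.lTensor E) ∘ₗ
    (LinearEquiv.ofInjective (A.domain.subtype.lTensor E)
      (Module.Flat.lTensor_preserves_injective_linearMap _
        A.domain.injective_subtype)).symm.toLinearMap

/-- The partial trace over the finite-dimensional factor `E`: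
`tr_E T = ∑ i, (⟨e i| ⊗ 1) T (|e i⟩ ⊗ 1)` for an orthonormal basis `e` of `E`. -/
def partialTrace [FiniteDimensional ℂ E] (T : E ⊗[ℂ] F →L[ℂ] E ⊗[ℂ] F) : F →L[ℂ] F :=
  ∑ i, braL F (stdOrthonormalBasis ℂ E i) ∘L T ∘L
    TensorProduct.mkL ℂ E F (stdOrthonormalBasis ℂ E i)

end Tensor

section Hilbert

variable {K : Type*} [NormedAddCommGroup K] [InnerProductSpace ℂ K]

/-- The trace of a (trace class) operator on a Hilbert space of any dimension:
`tr T = ∑ b, ⟪b, T b⟫` over a Hilbert basis. -/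
def trace [CompleteSpace K] (T : K →L[ℂ] K) : ℂ :=
  ∑' i, ⟪(exists_hilbertBasis ℂ K).choose_spec.choose i,
    T ((exists_hilbertBasis ℂ K).choose_spec.choose i)⟫_ℂ

/-- `‖A‖ = sup_{φ ≠ 0} ‖A φ‖ / ‖φ‖` for a possibly unbounded operator, the supremum being over the
domain of `A`; it is `∞` exactly if `A` is unbounded. -/
def opENorm (A : K →ₗ.[ℂ] K) : ℝ≥0∞ :=
  ⨆ (φ : A.domain) (_ : (φ : K) ≠ 0), ‖A φ‖ₑ / ‖(φ : K)‖ₑ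

/-- The commutator `[A, B] = A B - B A` of a possibly unbounded operator `A` and a bounded
operator `B`, on its natural domain `{φ ∈ D(A) | B φ ∈ D(A)}`. -/
def commutator (A : K →ₗ.[ℂ] K) (B : K →L[ℂ] K) : K →ₗ.[ℂ] K where
  domain := A.domain ⊓ A.domain.comap B.toLinearMap
  toFun :=
    { toFun := fun φ => A ⟨B φ, φ.2.2⟩ - B (A ⟨φ, φ.2.1⟩)
      map_add' := fun φ ψ => by
        have h₁ : (⟨B ((φ + ψ : _) : K), (φ + ψ).2.2⟩ : A.domain)
            = ⟨B φ, φ.2.2⟩ + ⟨B ψ, ψ.2.2⟩ := Subtype.ext (map_add B (φ : K) (ψ : K))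
        have h₂ : (⟨((φ + ψ : _) : K), (φ + ψ).2.1⟩ : A.domain)
            = ⟨φ, φ.2.1⟩ + ⟨ψ, ψ.2.1⟩ := rfl
        rw [h₁, h₂, A.map_add, A.map_add, map_add]
        abel
      map_smul' := fun c φ => by
        have h₁ : (⟨B ((c • φ : _) : K), (c • φ).2.2⟩ : A.domain)
            = c • ⟨B φ, φ.2.2⟩ := Subtype.ext (map_smul B c (φ : K))
        have h₂ : (⟨((c • φ : _) : K), (c • φ).2.1⟩ : A.domain)
            = c • ⟨φ, φ.2.1⟩ := rfl
        rw [h₁, h₂, A.map_smul, A.map_smul, map_smul, RingHom.id_apply, smul_sub] }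

/-- `U` is the strongly continuous one-parameter unitary group `U(t) = exp(-i H t / ħ)` whose
generator (with its exact domain) is the operator `H`. -/
structure IsUnitaryGroupOf [CompleteSpace K] (H : K →ₗ.[ℂ] K) (hbar : ℝ)
    (U : ℝ → K →L[ℂ] K) : Prop where
  unitary : ∀ t, U t ∈ unitary (K →L[ℂ] K)
  map_add : ∀ s t, U (s + t) = U s * U t
  continuous : ∀ ψ, Continuous fun t => U t ψ
  generator : ∀ ψ η, (ψ, η) ∈ H.graph ↔
    HasDerivAt (fun t => U t ψ) ((-(Complex.I / (hbar : ℂ))) • η) 0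

open scoped Classical in
/-- The time evolution `U(t) = exp(-i H t / ħ)` of a self-adjoint operator `H`: the strongly
continuous one-parameter unitary group generated by `H`. It exists for every self-adjoint `H` by
Stone's theorem and is unique; for other operators the value is irrelevant. -/
def timeEvolution [CompleteSpace K] (H : K →ₗ.[ℂ] K) (hbar : ℝ) : ℝ → K →L[ℂ] K :=
  if h : ∃ U, IsUnitaryGroupOf H hbar U then h.choose else fun _ => 1

variable [CompleteSpace K]

/-- The domain of `H` is invariant under `U(t)`, and `U(t) ψ` solves the Schrödinger equation. -/
theorem IsUnitaryGroupOf.hasDerivAt {H : K →ₗ.[ℂ] K} {hbar : ℝ}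
    {U : ℝ → K →L[ℂ] K} (h : IsUnitaryGroupOf H hbar U) (ψ : H.domain) (t : ℝ) :
    ∃ ht : U t ψ ∈ H.domain,
      HasDerivAt (fun s => U s ψ) ((-(Complex.I / (hbar : ℂ))) • H ⟨U t ψ, ht⟩) t := by
  have h0 := (h.generator ψ (H ψ)).1 (H.mem_graph ψ)
  have h1 : HasDerivAt (fun s => U (t + s) ψ) (U t ((-(Complex.I / (hbar : ℂ))) • H ψ)) 0 := by
    have h2 := ((U t).restrictScalars ℝ).hasFDerivAt.comp_hasDerivAt (0 : ℝ) h0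
    refine h2.congr_of_eventuallyEq (Filter.Eventually.of_forall fun s => ?_)
    simp [h.map_add]
  have h2 : HasDerivAt (fun s => U s (U t ψ)) ((-(Complex.I / (hbar : ℂ))) • U t (H ψ)) 0 := by
    rw [← map_smul]
    refine h1.congr_of_eventuallyEq (Filter.Eventually.of_forall fun s => ?_)
    simp [add_comm t s, h.map_add]
  have h3 := (h.generator _ _).2 h2
  obtain ⟨y, hy, hy'⟩ := H.mem_graph_iff.1 h3
  have ht : U t ψ ∈ H.domain := by
    have := y.2
    rwa [hy] at this
  refine ⟨ht, ?_⟩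
  have hyy : y = ⟨U t ψ, ht⟩ := Subtype.ext hy
  rw [← hyy, hy', ← map_smul]
  have h4 : HasDerivAt (fun s => U (t + s) ψ) (U t ((-(Complex.I / (hbar : ℂ))) • H ψ)) (t - t) := by
    rwa [sub_self]
  have h5 := h4.comp_sub_const t t
  simpa using h5

/-- The unitary group generated by a self-adjoint operator is unique. -/
theorem IsUnitaryGroupOf.eq {H : K →ₗ.[ℂ] K} (hH : IsSelfAdjoint H) {hbar : ℝ}
    {U W : ℝ → K →L[ℂ] K} (hU : IsUnitaryGroupOf H hbar U) (hW : IsUnitaryGroupOf H hbar W) :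
    U = W := by
  have hsym : H.IsFormalAdjoint H := by
    have := LinearPMap.adjoint_isFormalAdjoint hH.dense_domain
    rwa [LinearPMap.isSelfAdjoint_def.1 hH] at this
  have one : ∀ {U : ℝ → K →L[ℂ] K}, IsUnitaryGroupOf H hbar U → U 0 = 1 := by
    intro U hU
    have h1 : U 0 = U 0 * U 0 := by simpa using hU.map_add 0 0
    have h2 := (Unitary.mem_iff.1 (hU.unitary 0)).1
    calc U 0 = star (U 0) * U 0 * U 0 := by rw [h2, one_mul]
      _ = 1 := by rw [mul_assoc, ← h1, h2]
  funext t
  refine ContinuousLinearMap.ext_on (s := (H.domain : Set K))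
    (by rw [Submodule.span_eq]; exact hH.dense_domain) (fun ψ hψ => ?_)
  have hd : ∀ s, HasDerivAt (fun s => ⟪U s ψ - W s ψ, U s ψ - W s ψ⟫_ℂ) 0 s := by
    intro s
    obtain ⟨a, ha⟩ := hU.hasDerivAt ⟨ψ, hψ⟩ s
    obtain ⟨b, hb⟩ := hW.hasDerivAt ⟨ψ, hψ⟩ s
    have hab := ha.sub hb
    have hin := hab.inner ℂ hab
    refine hin.congr_deriv ?_
    rw [← smul_sub, ← H.map_sub]
    have := hsym (⟨U s ψ, a⟩ - ⟨W s ψ, b⟩) (⟨U s ψ, a⟩ - ⟨W s ψ, b⟩)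
    simp only [AddSubgroupClass.coe_sub] at this
    simp only [Pi.sub_apply]
    rw [inner_smul_left, inner_smul_right, this]
    simp only [map_neg, map_div₀, Complex.conj_I, Complex.conj_ofReal]
    ring
  have hc := is_const_of_deriv_eq_zero (fun s => (hd s).differentiableAt) (fun s => (hd s).deriv) t 0
  simp only [one hU, one hW, sub_self, inner_zero_left] at hc
  exact sub_eq_zero.1 (inner_self_eq_zero.1 hc)

/-- The time evolution is the unitary group generated by `H`. -/
theorem timeEvolution_eq {H : K →ₗ.[ℂ] K} (hH : IsSelfAdjoint H) {hbar : ℝ}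
    {U : ℝ → K →L[ℂ] K} (hU : IsUnitaryGroupOf H hbar U) : timeEvolution H hbar = U := by
  have h : ∃ U, IsUnitaryGroupOf H hbar U := ⟨U, hU⟩
  rw [timeEvolution, dif_pos h]
  exact h.choose_spec.eq hH hU

/-- For a bounded self-adjoint operator the time evolution is the exponential series. -/
theorem timeEvolution_toPMap {A : K →L[ℂ] K} (hA : IsSelfAdjoint A) {hbar : ℝ}
    (hbar0 : hbar ≠ 0) (t : ℝ) :
    timeEvolution (A.toLinearMap.toPMap ⊤) hbar t =
      NormedSpace.exp ((-(Complex.I * t / (hbar : ℂ))) • A) := by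
  have hS : IsSelfAdjoint (A.toLinearMap.toPMap ⊤) := by
    rw [LinearPMap.isSelfAdjoint_def]
    have := ContinuousLinearMap.toPMap_adjoint_eq_adjoint_toPMap_of_dense A (p := ⊤) (by simp)
    rw [← ContinuousLinearMap.star_eq_adjoint, hA.star_eq] at this
    exact this
  set B : K →L[ℂ] K := (-(Complex.I / (hbar : ℂ))) • A with hB
  have hsB : star B = -B := by
    rw [hB, star_smul, hA.star_eq, ← neg_smul]
    congr 1
    simp [neg_div]
  suffices hU : IsUnitaryGroupOf (A.toLinearMap.toPMap ⊤) hbar (fun t => NormedSpace.exp (t • B)) by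
    rw [timeEvolution_eq hS hU]
    have : (-(Complex.I * t / (hbar : ℂ))) • A = t • B := by
      rw [hB, ← Complex.coe_smul, smul_smul]; congr 1; ring
    rw [this]
  have hadd : ∀ s t : ℝ, NormedSpace.exp ((s + t) • B) =
      NormedSpace.exp (s • B) * NormedSpace.exp (t • B) := by
    intro s t
    rw [add_smul]
    let : NormedAlgebra ℚ (K →L[ℂ] K) := NormedAlgebra.restrictScalars ℚ ℂ _
    exact NormedSpace.exp_add_of_commute (((Commute.refl B).smul_left s).smul_right t)
  have hneg : ∀ t : ℝ, star (NormedSpace.exp (t • B)) = NormedSpace.exp ((-t) • B) := by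
    intro t
    rw [NormedSpace.star_exp, star_smul, hsB]; simp
  have hder : ∀ t : ℝ, ∀ ψ : K,
      HasDerivAt (fun t : ℝ => NormedSpace.exp (t • B) ψ) ((NormedSpace.exp (t • B) * B) ψ) t := by
    intro t ψ
    have h1 := hasDerivAt_exp_smul_const (𝕂 := ℝ) B t
    exact ((ContinuousLinearMap.apply ℂ K ψ).restrictScalars ℝ).hasFDerivAt.comp_hasDerivAt t h1
  refine ⟨fun t => Unitary.mem_iff.2 ⟨?_, ?_⟩, hadd, fun ψ => ?_, fun ψ η => ?_⟩
  · rw [hneg, ← hadd]; simp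
  · rw [hneg, ← hadd]; simp
  · exact continuous_iff_continuousAt.2 fun t => (hder t ψ).continuousAt
  · have h0 := hder 0 ψ
    simp only [zero_smul, NormedSpace.exp_zero, one_mul] at h0
    rw [LinearPMap.mem_graph_iff]
    constructor
    · rintro ⟨y, hy, hy'⟩
      obtain rfl : (y : K) = ψ := hy
      obtain rfl : A y = η := hy'
      exact h0
    · intro h
      have h1 := h.unique h0
      rw [hB, _root_.smul_apply] at h1
      refine ⟨⟨ψ, trivial⟩, rfl, ?_⟩
      have hne : (-(Complex.I / (hbar : ℂ))) ≠ 0 := by simp [hbar0]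
      exact (smul_right_injective K hne h1).symm

end Hilbert

section Measurement

variable {HS HA : Type*} [NormedAddCommGroup HS] [InnerProductSpace ℂ HS]
  [FiniteDimensional ℂ HS]
  [NormedAddCommGroup HA] [InnerProductSpace ℂ HA] [CompleteSpace HA]

/-- The sum `H_S ⊗ 1 + 1 ⊗ H_A + V` on `D(1 ⊗ H_A) ∩ D(V)`. -/
def hamiltonianSum (hamS : HS →L[ℂ] HS) (hamA : HA →ₗ.[ℂ] HA)
    (V : (HS ⊗[ℂ] HA) →ₗ.[ℂ] (HS ⊗[ℂ] HA)) : (HS ⊗[ℂ] HA) →ₗ.[ℂ] (HS ⊗[ℂ] HA) :=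
  (hamS.rTensor HA).toLinearMap.toPMap ⊤ + idTensor HS hamA + V

/-- The total Hamiltonian: the closure of `H_S ⊗ 1 + 1 ⊗ H_A + V`. -/
def totalHamiltonian (hamS : HS →L[ℂ] HS) (hamA : HA →ₗ.[ℂ] HA)
    (V : (HS ⊗[ℂ] HA) →ₗ.[ℂ] (HS ⊗[ℂ] HA)) : (HS ⊗[ℂ] HA) →ₗ.[ℂ] (HS ⊗[ℂ] HA) :=
  (hamiltonianSum hamS hamA V).closure

/-- The state of the apparatus at time `τ`,
`tr_S (U(τ) (|q⟩⟨q| ⊗ |Ω⟩⟨Ω|) U(τ)*)` with `U(τ) = exp(-i H τ / ħ)`. -/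
def apparatusState (H : (HS ⊗[ℂ] HA) →ₗ.[ℂ] (HS ⊗[ℂ] HA)) (hbar τ : ℝ) (q : HS) (Ω : HA) :
    HA →L[ℂ] HA :=
  partialTrace
    (timeEvolution H hbar τ *
      TensorProduct.mapL (InnerProductSpace.rankOne ℂ q q) (InnerProductSpace.rankOne ℂ Ω Ω) *
      star (timeEvolution H hbar τ))

/-- The average error `(p(1|0) + p(0|1)) / 2` of the pointer observable `Z`, where
`p(1|j) = tr (ρ_j Z)` and `p(0|j) = tr (ρ_j (1 - Z))`, and `ρ_j` is the final state of the
apparatus for the initial state `q_j` of the system. -/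
def errorProb (H : (HS ⊗[ℂ] HA) →ₗ.[ℂ] (HS ⊗[ℂ] HA)) (hbar τ : ℝ) (q₀ q₁ : HS) (Ω : HA)
    (Z : HA →L[ℂ] HA) : ℝ :=
  ((trace (apparatusState H hbar τ q₀ Ω * Z)).re +
    (trace (apparatusState H hbar τ q₁ Ω * (1 - Z))).re) / 2

end Measurement

end QMeasure

end

/-!
The observable `T = H_S ⊗ 1` is followed between the two measurement runs. With `Φ j = U(τ) (q j ⊗ Ω)`
one compares the matrix element `⟪q₁, H_S q₀⟫ = ⟪q₁ ⊗ Ω, T (q₀ ⊗ Ω)⟫` with `⟪Φ 1, T (Φ 0)⟫`.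

* In two dimensions `‖[Q, H_S]‖` is `|⟪q₁, H_S q₀⟫|` (`norm_commutator_le_of_finrank_eq_two`).
* `T` commutes with the pointer projection `1 ⊗ Z`, so that `⟪Φ 1, T (Φ 0)⟫` splits into the two
  pointer outcomes. By the Born rule (`trace_apparatusState_mul`) one factor in each outcome is an
  error amplitude, and Cauchy-Schwarz bounds the sum by `2 ‖H_S‖ √(P - P²)`
  (`norm_inner_le_of_commute_projection`).
* `T` commutes with `H_S ⊗ 1 + 1 ⊗ H_A`, so the matrix element `⟪U(t) ψ, T U(t) χ⟫` moves with speed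
  at most `‖[V, T]‖ / ħ`. On the domain of the sum this is symmetry of `H`. The resulting inequality
  for the sesquilinear form `⟪H ψ, T χ⟫ - ⟪T ψ, H χ⟫` passes to the closure of the graph
  (`norm_inner_sub_le_of_mem_graph_totalHamiltonian`), hence to `D(H)`, without discussing whether
  `T` preserves `D(H)`; integrating along the flow and using density of `D(H)` gives the drift bound
  (`IsUnitaryGroupOf.norm_inner_apply_sub_le`).

If `[V, T]` is unbounded, the claim has content only at `τ = 0`, where there is no drift.

That `U` is the genuine time evolution needs the existence half of Stone's theorem
(`exists_isUnitaryGroupOf`). It is proved by Yosida approximation: the resolvents `(1 ± i r A)⁻¹`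
yield commuting bounded skew-adjoint operators converging to `-i A / ħ` on `D(A)`, their exponentials
converge strongly, and the limit group has generator exactly `-i A / ħ` because a self-adjoint
operator has no proper symmetric extension.
-/

noncomputable section

namespace QMeasure

open Filter Topology

/-! ### Resolvents of self-adjoint operators -/

section Resolvent

variable {K : Type*} [NormedAddCommGroup K] [InnerProductSpace ℂ K] [CompleteSpace K]
  {A : K →ₗ.[ℂ] K}

theorem inner_graph_comm (hA : IsSelfAdjoint A) {x y u v : K} (h : (x, y) ∈ A.graph)
    (h' : (u, v) ∈ A.graph) : ⟪y, u⟫_ℂ = ⟪x, v⟫_ℂ := by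
  have hsym : A.IsFormalAdjoint A := by
    have := LinearPMap.adjoint_isFormalAdjoint hA.dense_domain
    rwa [LinearPMap.isSelfAdjoint_def.1 hA] at this
  obtain ⟨a, rfl, rfl⟩ := A.mem_graph_iff.1 h
  obtain ⟨b, rfl, rfl⟩ := A.mem_graph_iff.1 h'
  exact hsym a b

/-- The graph of a self-adjoint operator is maximal: it contains every pair that satisfies the
symmetry relation with all its members. -/
theorem mem_graph_of_inner (hA : IsSelfAdjoint A) {x y : K}
    (h : ∀ u v, (u, v) ∈ A.graph → ⟪v, x⟫_ℂ = ⟪u, y⟫_ℂ) : (x, y) ∈ A.graph := by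
  have h' : ∀ u : A.domain, ⟪y, (u : K)⟫_ℂ = ⟪x, A u⟫_ℂ := fun u => by
    rw [← inner_conj_symm, ← h u (A u) (A.mem_graph u), inner_conj_symm]
  have hx := LinearPMap.mem_adjoint_domain_of_exists (T := A) x ⟨y, h'⟩
  have h3 := LinearPMap.adjoint_apply_eq hA.dense_domain ⟨x, hx⟩ h'
  have h4 : (x, y) ∈ A.adjoint.graph := (LinearPMap.mem_graph_iff _).2 ⟨⟨x, hx⟩, rfl, h3⟩
  rwa [LinearPMap.isSelfAdjoint_def.1 hA] at h4

/-- `⟪x, A x⟫` is real, so `x` and `i r A x` are orthogonal for the real inner product. -/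
theorem norm_sub_I_smul_sq (hA : IsSelfAdjoint A) {x y : K} (h : (x, y) ∈ A.graph) (r : ℝ) :
    ‖x - (Complex.I * r) • y‖ ^ 2 = ‖x‖ ^ 2 + r ^ 2 * ‖y‖ ^ 2 := by
  have him : (⟪x, y⟫_ℂ).im = 0 := by
    have h1 := inner_graph_comm hA h h
    rw [← inner_conj_symm] at h1
    exact Complex.conj_eq_iff_im.1 h1
  have hre : (⟪x, (Complex.I * r) • y⟫_ℂ).re = 0 := by
    rw [inner_smul_right]
    simp [him]
  have h2 := @norm_sub_sq ℂ K _ _ _ x ((Complex.I * r) • y)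
  rw [h2]
  simp only [RCLike.re_to_complex, hre, norm_smul, norm_mul, Complex.norm_I, Complex.norm_real,
    Real.norm_eq_abs, mul_pow, sq_abs]
  ring

/-- `J` is the resolvent `(1 - i r A)⁻¹`: for `x = J y` one has `x ∈ D(A)` and
`x - i r A x = y`, the second equation being solved for `A x`. -/
def IsResolvent (A : K →ₗ.[ℂ] K) (r : ℝ) (J : K →L[ℂ] K) : Prop :=
  ∀ y, (J y, (Complex.I * r)⁻¹ • (J y - y)) ∈ A.graph

/-- On the graph of `A`, the map `(x, A x) ↦ x - i r A x` is bounded below, so its range is closed;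
a vector orthogonal to the range would be an eigenvector of `A` with eigenvalue `i / r`. -/
theorem exists_isResolvent (hA : IsSelfAdjoint A) {r : ℝ} (hr : r ≠ 0) :
    ∃ J, IsResolvent A r J := by
  have hc : (Complex.I * r : ℂ) ≠ 0 := by simp [hr]
  have : CompleteSpace A.graph := hA.isClosed.completeSpace_coe
  let T : A.graph →L[ℂ] K :=
    (ContinuousLinearMap.fst ℂ K K - (Complex.I * r : ℂ) • ContinuousLinearMap.snd ℂ K K) ∘L
      A.graph.subtypeL
  have hT : ∀ p : A.graph, T p = (p : K × K).1 - (Complex.I * r : ℂ) • (p : K × K).2 :=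
    fun p => rfl
  have hsq : ∀ p : A.graph,
      ‖T p‖ ^ 2 = ‖(p : K × K).1‖ ^ 2 + r ^ 2 * ‖(p : K × K).2‖ ^ 2 :=
    fun p => norm_sub_I_smul_sq hA p.2 r
  have hanti : AntilipschitzWith (Real.toNNReal (max 1 |r|⁻¹)) T := by
    refine ContinuousLinearMap.antilipschitz_of_bound T fun p => ?_
    rw [Real.coe_toNNReal _ (by positivity)]
    have hr' : 0 < |r| := abs_pos.2 hr
    have h1 : ‖(p : K × K).1‖ ≤ ‖T p‖ :=
      (sq_le_sq₀ (norm_nonneg _) (norm_nonneg _)).1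
        (by rw [hsq]; exact le_add_of_nonneg_right (by positivity))
    have h2 : |r| * ‖(p : K × K).2‖ ≤ ‖T p‖ :=
      (sq_le_sq₀ (by positivity) (norm_nonneg _)).1
        (by rw [hsq, mul_pow, sq_abs]; exact le_add_of_nonneg_left (by positivity))
    have h3 : ‖(p : K × K).2‖ ≤ |r|⁻¹ * ‖T p‖ := by
      rw [inv_mul_eq_div, le_div_iff₀ hr']; linarith
    change max ‖(p : K × K).1‖ ‖(p : K × K).2‖ ≤ _
    refine max_le ?_ ?_
    · exact h1.trans (le_mul_of_one_le_left (norm_nonneg _) (le_max_left _ _))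
    · exact h3.trans (mul_le_mul_of_nonneg_right (le_max_right _ _) (norm_nonneg _))
  have hcl : IsClosed (T.range : Set K) := by
    have := hanti.isClosed_range T.uniformContinuous
    exact this
  have hrange : T.range = ⊤ := by
    have : CompleteSpace T.range := hcl.completeSpace_coe
    rw [← Submodule.orthogonal_eq_bot_iff, Submodule.eq_bot_iff]
    intro y hy
    rw [Submodule.mem_orthogonal] at hy
    have h1 : (y, (Complex.I / r) • y) ∈ A.graph := by
      refine mem_graph_of_inner hA fun u v huv => ?_
      have h2 := hy (T ⟨(u, v), huv⟩) ⟨_, rfl⟩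
      rw [hT, inner_sub_left, inner_smul_left, sub_eq_zero] at h2
      rw [inner_smul_right, h2]
      have : (r : ℂ) ≠ 0 := by simp [hr]
      simp only [map_mul, Complex.conj_I, Complex.conj_ofReal]
      field_simp
      rw [Complex.I_sq]; ring
    have h3 := inner_graph_comm hA h1 h1
    rw [inner_smul_left, inner_smul_right] at h3
    simp only [map_div₀, Complex.conj_I, Complex.conj_ofReal] at h3
    by_contra hy0
    have h4 : ⟪y, y⟫_ℂ ≠ 0 := inner_self_ne_zero.2 hy0
    have h5 := mul_right_cancel₀ h4 h3
    have : (r : ℂ) ≠ 0 := by simp [hr]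
    field_simp at h5
    norm_num at h5
  let e := ContinuousLinearEquiv.ofBijective T
    (LinearMap.ker_eq_bot.2 hanti.injective) hrange
  refine ⟨ContinuousLinearMap.fst ℂ K K ∘L A.graph.subtypeL ∘L e.symm.toContinuousLinearMap,
    fun y => ?_⟩
  have h1 : T (e.symm y) = y := e.apply_symm_apply y
  rw [hT] at h1
  have h2 := (e.symm y).2
  convert h2 using 1
  refine Prod.ext rfl ?_
  simp only [ContinuousLinearMap.comp_apply, ContinuousLinearMap.coe_fst']
  nth_rw 2 [← h1]
  change (Complex.I * r : ℂ)⁻¹ • ((e.symm y : K × K).1 - _) = _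
  rw [sub_sub_cancel, inv_smul_smul₀ hc]

namespace IsResolvent

variable {r s : ℝ} {J J' : K →L[ℂ] K}

theorem norm_apply_le (hJ : IsResolvent A r J) (hA : IsSelfAdjoint A) (hr : r ≠ 0) (y : K) :
    ‖J y‖ ≤ ‖y‖ := by
  have hc : (Complex.I * r : ℂ) ≠ 0 := by simp [hr]
  have h := norm_sub_I_smul_sq hA (hJ y) r
  rw [smul_smul, mul_inv_cancel₀ hc, one_smul, sub_sub_cancel] at h
  refine (sq_le_sq₀ (norm_nonneg _) (norm_nonneg _)).1 ?_
  rw [h]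
  exact le_add_of_nonneg_right (by positivity)

theorem apply_sub (hJ : IsResolvent A r J) (hA : IsSelfAdjoint A) (hr : r ≠ 0) {x z : K}
    (h : (x, z) ∈ A.graph) : J (x - (Complex.I * r) • z) = x := by
  have hc : (Complex.I * r : ℂ) ≠ 0 := by simp [hr]
  have h1 := A.graph.sub_mem (hJ (x - (Complex.I * r) • z)) h
  have h2 := norm_sub_I_smul_sq hA h1 r
  dsimp only at h2
  rw [smul_sub (Complex.I * r : ℂ), smul_inv_smul₀ hc] at h2
  have h3 : J (x - (Complex.I * r) • z) - x -
      (J (x - (Complex.I * r) • z) - (x - (Complex.I * r) • z) - (Complex.I * r) • z) = 0 := by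
    abel
  rw [h3, norm_zero] at h2
  have h4 : ‖J (x - (Complex.I * r) • z) - x‖ ^ 2 = 0 := by
    have := sq_nonneg ‖J (x - (Complex.I * r) • z) - x‖
    have := mul_nonneg (sq_nonneg r) (sq_nonneg ‖(Complex.I * r : ℂ)⁻¹ •
      (J (x - (Complex.I * r) • z) - (x - (Complex.I * r) • z)) - z‖)
    linarith
  exact sub_eq_zero.1 (norm_eq_zero.1 (pow_eq_zero_iff two_ne_zero |>.1 h4))

/-- The resolvent preserves `D(A)` and commutes with `A` there. -/
theorem map_graph (hJ : IsResolvent A r J) (hA : IsSelfAdjoint A) (hr : r ≠ 0) {x z : K}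
    (h : (x, z) ∈ A.graph) : (J x, J z) ∈ A.graph := by
  have hc : (Complex.I * r : ℂ) ≠ 0 := by simp [hr]
  have h1 := A.graph.smul_mem (Complex.I * r : ℂ)⁻¹ (A.graph.sub_mem (hJ x) h)
  have h2 := hJ.apply_sub hA hr h1
  have h3 : J z = (Complex.I * r : ℂ)⁻¹ • (J x - x) := by
    refine Eq.trans (congrArg J ?_) h2
    rw [smul_inv_smul₀ hc]
    simp only [Prod.fst_sub, Prod.snd_sub]
    rw [sub_sub_cancel]
  rw [h3]
  exact hJ x

theorem commute (hJ : IsResolvent A r J) (hJ' : IsResolvent A s J') (hA : IsSelfAdjoint A)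
    (hr : r ≠ 0) (hs : s ≠ 0) : Commute J J' := by
  have hc : (Complex.I * s : ℂ) ≠ 0 := by simp [hs]
  refine ContinuousLinearMap.ext fun y => ?_
  have h1 := hJ.map_graph hA hr (hJ' y)
  have h2 := hJ'.apply_sub hA hs h1
  simp only [mul_apply_eq_comp]
  rw [← h2]
  rw [map_smul, smul_inv_smul₀ hc, map_sub J, sub_sub_cancel]

theorem star_eq (hJ : IsResolvent A r J) (hJ' : IsResolvent A (-r) J') (hA : IsSelfAdjoint A)
    (hr : r ≠ 0) : star J = J' := by
  rw [ContinuousLinearMap.star_eq_adjoint]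
  symm
  rw [ContinuousLinearMap.eq_adjoint_iff]
  intro x y
  have h := inner_graph_comm hA (hJ' x) (hJ y)
  simp only [inner_smul_left, inner_smul_right, inner_sub_left, inner_sub_right, map_inv₀,
    map_mul, Complex.conj_I, Complex.ofReal_neg, map_neg, Complex.conj_ofReal] at h
  have h0 : (-Complex.I * -(r : ℂ))⁻¹ = (Complex.I * r)⁻¹ := by ring_nf
  rw [h0] at h
  have hc : (Complex.I * r : ℂ)⁻¹ ≠ 0 := by simp [hr]
  have := mul_left_cancel₀ hc h
  exact (sub_right_inj.1 this).symm

end IsResolvent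

end Resolvent

/-! ### Stone's theorem -/

section Stone

variable {K : Type*} [NormedAddCommGroup K] [InnerProductSpace ℂ K]

theorem tendsto_of_contraction_of_dense {T : ℕ → K →L[ℂ] K} (hT : ∀ n x, ‖T n x‖ ≤ ‖x‖)
    {s : Set K} (hs : Dense s) (h : ∀ x ∈ s, Tendsto (fun n => T n x) atTop (𝓝 x)) (x : K) :
    Tendsto (fun n => T n x) atTop (𝓝 x) := by
  rw [Metric.tendsto_atTop]
  intro ε hε
  obtain ⟨y, hy, hxy⟩ := Metric.dense_iff.1 hs x (ε / 3) (by positivity)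
  obtain ⟨N, hN⟩ := Metric.tendsto_atTop.1 (h y hxy) (ε / 3) (by positivity)
  refine ⟨N, fun n hn => ?_⟩
  have h1 := hN n hn
  have h2 := hT n (x - y)
  rw [Metric.mem_ball, dist_comm] at hy
  rw [map_sub] at h2
  rw [dist_eq_norm] at h1 hy ⊢
  calc ‖T n x - x‖ = ‖(T n x - T n y) + (T n y - y) - (x - y)‖ := by congr 1; abel
    _ ≤ ‖T n x - T n y‖ + ‖T n y - y‖ + ‖x - y‖ :=
      (norm_sub_le _ _).trans (add_le_add_left (norm_add_le _ _) _)
    _ < ε := by linarith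

theorem cauchySeq_of_contraction_of_dense {T : ℕ → K →L[ℂ] K} (hT : ∀ n x, ‖T n x‖ ≤ ‖x‖)
    {s : Set K} (hs : Dense s) (h : ∀ x ∈ s, CauchySeq fun n => T n x) (x : K) :
    CauchySeq fun n => T n x := by
  rw [Metric.cauchySeq_iff']
  intro ε hε
  obtain ⟨y, hy, hxy⟩ := Metric.dense_iff.1 hs x (ε / 3) (by positivity)
  obtain ⟨N, hN⟩ := Metric.cauchySeq_iff'.1 (h y hxy) (ε / 3) (by positivity)
  refine ⟨N, fun n hn => ?_⟩
  have h1 := hN n hn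
  have h2 := hT n (x - y)
  have h3 := hT N (x - y)
  rw [Metric.mem_ball, dist_comm] at hy
  rw [map_sub] at h2 h3
  rw [dist_eq_norm] at h1 hy ⊢
  calc ‖T n x - T N x‖ = ‖(T n x - T n y) + (T n y - T N y) - (T N x - T N y)‖ := by
        congr 1; abel
    _ ≤ ‖T n x - T n y‖ + ‖T n y - T N y‖ + ‖T N x - T N y‖ :=
      (norm_sub_le _ _).trans (add_le_add_left (norm_add_le _ _) _)
    _ < ε := by linarith

theorem continuous_of_lipschitz_on_dense {U : ℝ → K →L[ℂ] K} (hU : ∀ t x, ‖U t x‖ = ‖x‖)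
    {s : Set K} (hs : Dense s)
    (h : ∀ x ∈ s, ∃ C, ∀ a b, ‖U a x - U b x‖ ≤ |a - b| * C) (x : K) :
    Continuous fun t => U t x := by
  rw [Metric.continuous_iff]
  intro b ε hε
  obtain ⟨y, hy, hys⟩ := Metric.dense_iff.1 hs x (ε / 3) (by positivity)
  obtain ⟨C, hC⟩ := h y hys
  refine ⟨ε / 3 / (|C| + 1), by positivity, fun a hab => ?_⟩
  rw [Real.dist_eq, lt_div_iff₀ (by positivity)] at hab
  have h1 := hU a (x - y)
  have h2 := hU b (x - y)
  have h3 : ‖U a y - U b y‖ < ε / 3 := by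
    refine (hC a b).trans_lt (lt_of_le_of_lt ?_ hab)
    exact mul_le_mul_of_nonneg_left ((le_abs_self C).trans (by linarith)) (abs_nonneg _)
  rw [Metric.mem_ball, dist_comm, dist_eq_norm] at hy
  rw [_root_.map_sub] at h1 h2
  rw [dist_eq_norm]
  calc ‖U a x - U b x‖ = ‖(U a x - U a y) + (U a y - U b y) - (U b x - U b y)‖ := by
        congr 1; abel
    _ ≤ ‖U a x - U a y‖ + ‖U a y - U b y‖ + ‖U b x - U b y‖ :=
      (norm_sub_le _ _).trans (add_le_add_left (norm_add_le _ _) _)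
    _ < ε := by linarith

variable [CompleteSpace K] {A : K →ₗ.[ℂ] K}

/-- `(1 - i r A)⁻¹ → 1` strongly as `r → 0`: on `D(A)` the difference is `i r (1 - i r A)⁻¹ A x`. -/
theorem IsResolvent.tendsto_apply (hA : IsSelfAdjoint A) {r : ℕ → ℝ} {J : ℕ → K →L[ℂ] K}
    (hJ : ∀ n, IsResolvent A (r n) (J n)) (hr : ∀ n, r n ≠ 0) (hr0 : Tendsto r atTop (𝓝 0))
    (x : K) : Tendsto (fun n => J n x) atTop (𝓝 x) := by
  refine tendsto_of_contraction_of_dense (fun n => (hJ n).norm_apply_le hA (hr n))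
    hA.dense_domain (fun u hu => ?_) x
  obtain ⟨v, huv⟩ := LinearPMap.mem_domain_iff.1 hu
  rw [tendsto_iff_norm_sub_tendsto_zero]
  refine squeeze_zero (g := fun n => |r n| * ‖v‖) (fun n => norm_nonneg _) (fun n => ?_) ?_
  · have h1 := (hJ n).apply_sub hA (hr n) huv
    rw [map_sub, map_smul, sub_eq_iff_eq_add, ← sub_eq_iff_eq_add'] at h1
    rw [h1, norm_smul, norm_mul, Complex.norm_I, one_mul, Complex.norm_real, Real.norm_eq_abs]
    exact mul_le_mul_of_nonneg_left ((hJ n).norm_apply_le hA (hr n) v) (abs_nonneg _)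
  · simpa using (hr0.abs).mul_const ‖v‖

/-- The Yosida approximants `(c / 2r) ((1 + i r A)⁻¹ - (1 - i r A)⁻¹) = -i c A (1 + r² A²)⁻¹` of
`-i c A`, along `r = 1 / (n + 1)`. -/
theorem exists_skewAdjoint_approx (hA : IsSelfAdjoint A) (c : ℝ) :
    ∃ B : ℕ → K →L[ℂ] K, (∀ n, star (B n) = -B n) ∧ (∀ m n, Commute (B m) (B n)) ∧
      ∀ x y, (x, y) ∈ A.graph →
        Tendsto (fun n => B n x) atTop (𝓝 ((-(Complex.I * c)) • y)) := by
  let r : ℕ → ℝ := fun n => 1 / ((n : ℝ) + 1)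
  have hr : ∀ n, r n ≠ 0 := fun n => by positivity
  have hr' : ∀ n, -r n ≠ 0 := fun n => neg_ne_zero.2 (hr n)
  have hr0 : Tendsto r atTop (𝓝 0) := tendsto_one_div_add_atTop_nhds_zero_nat
  choose J hJ using fun n => exists_isResolvent hA (hr n)
  choose J' hJ' using fun n => exists_isResolvent hA (hr' n)
  have hst : ∀ n, star (J n) = J' n := fun n => (hJ n).star_eq (hJ' n) hA (hr n)
  have hst' : ∀ n, star (J' n) = J n := fun n => by rw [← hst, star_star]
  refine ⟨fun n => ((c / (2 * r n) : ℝ) : ℂ) • (J' n - J n), fun n => ?_, fun m n => ?_,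
    fun x y hxy => ?_⟩
  · rw [star_smul, star_sub, hst, hst', ← smul_neg, neg_sub]
    simp
  · refine Commute.smul_left (Commute.smul_right ?_ _) _
    exact (((hJ' m).commute (hJ' n) hA (hr' m) (hr' n)).sub_right
      ((hJ' m).commute (hJ n) hA (hr' m) (hr n))).sub_left
      (((hJ m).commute (hJ' n) hA (hr m) (hr' n)).sub_right
        ((hJ m).commute (hJ n) hA (hr m) (hr n)))
  · have h0 : Tendsto (fun n => (-(Complex.I * c / 2)) • (J' n y + J n y)) atTop
        (𝓝 ((-(Complex.I * c / 2)) • (y + y))) :=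
      ((IsResolvent.tendsto_apply hA hJ' hr' (by simpa using hr0.neg) y).add
        (IsResolvent.tendsto_apply hA hJ hr hr0 y)).const_smul _
    have h1 : (-(Complex.I * c / 2)) • (y + y) = (-(Complex.I * c)) • y := by
      rw [← two_smul ℂ y, smul_smul]; congr 1; ring
    rw [h1] at h0
    refine h0.congr fun n => ?_
    have h2 := (hJ n).apply_sub hA (hr n) hxy
    have h3 := (hJ' n).apply_sub hA (hr' n) hxy
    rw [map_sub, map_smul, sub_eq_iff_eq_add] at h2 h3
    have hrc : (r n : ℂ) ≠ 0 := by exact_mod_cast hr n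
    rw [_root_.smul_apply, _root_.sub_apply, h2, h3, add_sub_add_left_eq_sub,
      smul_sub, smul_smul, smul_smul,
      show ((c / (2 * r n) : ℝ) : ℂ) * (Complex.I * ((-r n : ℝ) : ℂ)) = -(Complex.I * c / 2) by
        push_cast; field_simp,
      show ((c / (2 * r n) : ℝ) : ℂ) * (Complex.I * (r n : ℂ)) = Complex.I * c / 2 by
        push_cast; field_simp]
    module

section Skew

variable {B : K →L[ℂ] K}

theorem exp_smul_mem_unitary (hB : star B = -B) (t : ℝ) :
    NormedSpace.exp (t • B) ∈ unitary (K →L[ℂ] K) := by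
  have hneg : star (NormedSpace.exp (t • B)) = NormedSpace.exp (-(t • B)) := by
    rw [NormedSpace.star_exp, star_smul, hB]; simp
  let : NormedAlgebra ℚ (K →L[ℂ] K) := NormedAlgebra.restrictScalars ℚ ℂ _
  refine Unitary.mem_iff.2 ⟨?_, ?_⟩
  · rw [hneg, ← NormedSpace.exp_add_of_commute (Commute.refl _).neg_left]; simp
  · rw [hneg, ← NormedSpace.exp_add_of_commute (Commute.refl _).neg_right]; simp

theorem hasDerivAt_exp_smul_apply (t : ℝ) (x : K) :
    HasDerivAt (fun t : ℝ => NormedSpace.exp (t • B) x) (NormedSpace.exp (t • B) (B x)) t :=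
  ((ContinuousLinearMap.apply ℂ K x).restrictScalars ℝ).hasFDerivAt.comp_hasDerivAt t
    (hasDerivAt_exp_smul_const (𝕂 := ℝ) B t)

theorem continuous_exp_smul_apply (x : K) :
    Continuous fun t : ℝ => NormedSpace.exp (t • B) x :=
  continuous_iff_continuousAt.2 fun t => (hasDerivAt_exp_smul_apply t x).continuousAt

theorem norm_exp_smul_apply_sub_le (hB : star B = -B) (t : ℝ) (x : K) :
    ‖NormedSpace.exp (t • B) x - x‖ ≤ |t| * ‖B x‖ := by
  have h := Convex.norm_image_sub_le_of_norm_hasDerivWithin_le (s := Set.univ) (C := ‖B x‖)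
    (fun s _ => (hasDerivAt_exp_smul_apply (B := B) s x).hasDerivWithinAt)
    (fun s _ => (ContinuousLinearMap.norm_map_of_mem_unitary (exp_smul_mem_unitary hB s) _).le)
    convex_univ (Set.mem_univ 0) (Set.mem_univ t)
  simpa [mul_comm] using h

theorem exp_smul_apply_sub_eq_integral (t : ℝ) (x : K) :
    NormedSpace.exp (t • B) x - x = ∫ s in (0 : ℝ)..t, NormedSpace.exp (s • B) (B x) := by
  rw [intervalIntegral.integral_eq_sub_of_hasDerivAt
    (fun s _ => hasDerivAt_exp_smul_apply (B := B) s x)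
    ((continuous_exp_smul_apply (B x)).intervalIntegrable _ _)]
  simp

theorem exp_add_smul (s t : ℝ) : NormedSpace.exp ((s + t) • B) =
    NormedSpace.exp (s • B) * NormedSpace.exp (t • B) := by
  let : NormedAlgebra ℚ (K →L[ℂ] K) := NormedAlgebra.restrictScalars ℚ ℂ _
  rw [add_smul]
  exact NormedSpace.exp_add_of_commute (((Commute.refl B).smul_left s).smul_right t)

/-- Since `B` and `B'` commute, `exp (t B) = exp (t B') exp (t (B - B'))`. -/
theorem norm_exp_smul_apply_sub_exp_smul_apply_le {B' : K →L[ℂ] K} (hB : star B = -B)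
    (hB' : star B' = -B') (h : Commute B B') (t : ℝ) (x : K) :
    ‖NormedSpace.exp (t • B) x - NormedSpace.exp (t • B') x‖ ≤ |t| * ‖B x - B' x‖ := by
  have h1 : NormedSpace.exp (t • B) =
      NormedSpace.exp (t • B') * NormedSpace.exp (t • (B - B')) := by
    let : NormedAlgebra ℚ (K →L[ℂ] K) := NormedAlgebra.restrictScalars ℚ ℂ _
    rw [← NormedSpace.exp_add_of_commute
      (((h.symm.sub_right (Commute.refl B')).smul_left t).smul_right t), ← smul_add,
      add_sub_cancel]
  rw [h1, mul_apply_eq_comp, ← map_sub,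
    ContinuousLinearMap.norm_map_of_mem_unitary (exp_smul_mem_unitary hB' t)]
  exact norm_exp_smul_apply_sub_le (by rw [star_sub, hB, hB']; abel) t x

end Skew

theorem IsUnitaryGroupOf.map_zero {H : K →ₗ.[ℂ] K} {hbar : ℝ} {U : ℝ → K →L[ℂ] K}
    (hU : IsUnitaryGroupOf H hbar U) : U 0 = 1 := by
  have h1 : U 0 = U 0 * U 0 := by simpa using hU.map_add 0 0
  have h2 := (Unitary.mem_iff.1 (hU.unitary 0)).1
  calc U 0 = star (U 0) * U 0 * U 0 := by rw [h2, one_mul]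
    _ = 1 := by rw [mul_assoc, ← h1, h2]

/-- Commuting skew-adjoint operators that converge on a dense set have strongly convergent
exponentials. -/
theorem exists_tendsto_exp_smul {B : ℕ → K →L[ℂ] K} (hB : ∀ n, star (B n) = -B n)
    (hcomm : ∀ m n, Commute (B m) (B n)) {s : Set K} (hs : Dense s)
    (hlim : ∀ x ∈ s, CauchySeq fun n => B n x) (t : ℝ) :
    ∃ T : K →L[ℂ] K, ∀ x, Tendsto (fun n => NormedSpace.exp (t • B n) x) atTop (𝓝 (T x)) := by
  have hcau : ∀ x, CauchySeq fun n => NormedSpace.exp (t • B n) x := by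
    refine cauchySeq_of_contraction_of_dense
      (fun n x => (ContinuousLinearMap.norm_map_of_mem_unitary
        (exp_smul_mem_unitary (hB n) t) x).le) hs fun x hx => ?_
    rw [Metric.cauchySeq_iff']
    intro ε hε
    obtain ⟨N, hN⟩ := Metric.cauchySeq_iff'.1 (hlim x hx) (ε / (|t| + 1)) (by positivity)
    refine ⟨N, fun n hn => ?_⟩
    have h1 := hN n hn
    rw [dist_eq_norm, lt_div_iff₀ (by positivity)] at h1
    rw [dist_eq_norm]
    calc _ ≤ |t| * ‖B n x - B N x‖ :=
          norm_exp_smul_apply_sub_exp_smul_apply_le (hB n) (hB N) (hcomm n N) t x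
      _ ≤ ‖B n x - B N x‖ * (|t| + 1) := by nlinarith [norm_nonneg (B n x - B N x)]
      _ < ε := h1
  choose f hf using fun x => cauchySeq_tendsto_of_complete (hcau x)
  exact ⟨continuousLinearMapOfTendsto (fun n => NormedSpace.exp (t • B n))
    (f := f) (tendsto_pi_nhds.2 hf), hf⟩

/-- **Stone's theorem**, existence part. `U t` is the strong limit of the exponentials of the Yosida
approximants. Their integral equation passes to the limit by dominated convergence, so `U` is
differentiable on `D(A)`. -/
theorem exists_isUnitaryGroupOf (hA : IsSelfAdjoint A) {hbar : ℝ} (hbar0 : hbar ≠ 0) :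
    ∃ U, IsUnitaryGroupOf A hbar U := by
  obtain ⟨B, hB, hcomm, hlim⟩ := exists_skewAdjoint_approx hA hbar⁻¹
  have hc : -(Complex.I * ((hbar⁻¹ : ℝ) : ℂ)) = -(Complex.I / (hbar : ℂ)) := by
    push_cast; rw [div_eq_mul_inv]
  rw [hc] at hlim
  have hcau : ∀ x ∈ A.domain, CauchySeq fun n => B n x := fun x hx => by
    obtain ⟨y, hxy⟩ := LinearPMap.mem_domain_iff.1 hx
    exact (hlim x y hxy).cauchySeq
  have hW : ∀ n t x, ‖NormedSpace.exp ((t : ℝ) • B n) x‖ = ‖x‖ := fun n t x =>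
    ContinuousLinearMap.norm_map_of_mem_unitary (exp_smul_mem_unitary (hB n) t) x
  choose U hU using exists_tendsto_exp_smul hB hcomm hA.dense_domain hcau
  have hnorm : ∀ t x, ‖U t x‖ = ‖x‖ := fun t x =>
    tendsto_nhds_unique (hU t x).norm (by simp [hW])
  -- strong limits of contractions are compatible with moving vectors
  have hmove : ∀ t (x : ℕ → K) x', Tendsto x atTop (𝓝 x') →
      Tendsto (fun n => NormedSpace.exp (t • B n) (x n)) atTop (𝓝 (U t x')) := by
    intro t x x' hx
    have h1 : Tendsto (fun n => NormedSpace.exp (t • B n) (x n - x')) atTop (𝓝 0) := by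
      rw [tendsto_zero_iff_norm_tendsto_zero]
      simp only [hW]
      exact tendsto_iff_norm_sub_tendsto_zero.1 hx
    simpa using h1.add (hU t x')
  have hadd : ∀ s t, U (s + t) = U s * U t := fun s t => ContinuousLinearMap.ext fun x => by
    refine tendsto_nhds_unique (hU (s + t) x) ?_
    simp only [exp_add_smul, mul_apply_eq_comp]
    exact hmove s _ _ (hU t x)
  have hzero : U 0 = 1 := ContinuousLinearMap.ext fun x =>
    tendsto_nhds_unique (hU 0 x) (by simp)
  have hstar : ∀ t, star (U t) * U t = 1 := fun t => by
    rw [ContinuousLinearMap.star_eq_adjoint]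
    exact (ContinuousLinearMap.norm_map_iff_adjoint_comp_self _).1 (hnorm t)
  have hunit : ∀ t, U t ∈ unitary (K →L[ℂ] K) := fun t => by
    have h1 : U t * U (-t) = 1 := by rw [← hadd, add_neg_cancel, hzero]
    refine Unitary.mem_iff.2 ⟨hstar t, ?_⟩
    rwa [left_inv_eq_right_inv (hstar t) h1]
  have hlip : ∀ x y, (x, y) ∈ A.graph → ∀ t,
      ‖U t x - x‖ ≤ |t| * ‖(-(Complex.I / (hbar : ℂ))) • y‖ := fun x y hxy t =>
    le_of_tendsto_of_tendsto' ((hU t x).sub_const x).norm ((hlim x y hxy).norm.const_mul |t|)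
      fun n => norm_exp_smul_apply_sub_le (hB n) t x
  have hcont : ∀ x, Continuous fun t => U t x := by
    refine continuous_of_lipschitz_on_dense hnorm hA.dense_domain fun x hx => ?_
    obtain ⟨y, hxy⟩ := LinearPMap.mem_domain_iff.1 hx
    refine ⟨‖(-(Complex.I / (hbar : ℂ))) • y‖, fun a b => ?_⟩
    have h1 : U a x - U b x = U b (U (a - b) x - x) := by
      rw [_root_.map_sub, ← mul_apply_eq_comp, ← hadd, add_sub_cancel]
    rw [h1, hnorm]
    exact hlip x y hxy (a - b)
  have hint : ∀ x y, (x, y) ∈ A.graph → ∀ t,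
      U t x = x + ∫ s in (0 : ℝ)..t, U s ((-(Complex.I / (hbar : ℂ))) • y) := by
    intro x y hxy t
    rw [← sub_eq_iff_eq_add']
    refine tendsto_nhds_unique ((hU t x).sub_const x) ?_
    simp only [exp_smul_apply_sub_eq_integral]
    obtain ⟨C, hC⟩ := (hlim x y hxy).norm.bddAbove_range
    refine intervalIntegral.tendsto_integral_filter_of_dominated_convergence (fun _ => C)
      (Eventually.of_forall fun n => (continuous_exp_smul_apply (B n x)).aestronglyMeasurable)
      (Eventually.of_forall fun n => Eventually.of_forall fun s _ => ?_)
      intervalIntegrable_const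
      (Eventually.of_forall fun s _ => hmove s _ _ (hlim x y hxy))
    rw [hW]
    exact hC ⟨n, rfl⟩
  have hder : ∀ x y, (x, y) ∈ A.graph →
      HasDerivAt (fun t => U t x) ((-(Complex.I / (hbar : ℂ))) • y) 0 := by
    intro x y hxy
    have h1 := (intervalIntegral.integral_hasDerivAt_right
      ((hcont ((-(Complex.I / (hbar : ℂ))) • y)).intervalIntegrable 0 0)
      ((hcont _).stronglyMeasurableAtFilter _ _) (hcont _).continuousAt).const_add x
    rw [hzero] at h1
    exact h1.congr_of_eventuallyEq (Eventually.of_forall (hint x y hxy))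
  refine ⟨U, hunit, hadd, hcont, fun ψ η => ⟨hder ψ η, fun h => ?_⟩⟩
  -- a self-adjoint operator has no proper symmetric extension
  refine mem_graph_of_inner hA fun u v huv => ?_
  have h1 := (hder u v huv).inner ℂ h
  have h2 : HasDerivAt (fun t => ⟪U t u, U t ψ⟫_ℂ) 0 0 := by
    refine (hasDerivAt_const 0 ⟪u, ψ⟫_ℂ).congr_of_eventuallyEq (Eventually.of_forall fun t => ?_)
    exact ContinuousLinearMap.inner_map_map_of_mem_unitary (hunit t) u ψ
  have h3 := h1.unique h2
  simp only [hzero, inner_smul_left, inner_smul_right, one_apply_eq_self, map_neg, map_div₀,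
    Complex.conj_I, Complex.conj_ofReal] at h3
  have hI : Complex.I / (hbar : ℂ) ≠ 0 := by simp [hbar0]
  refine mul_left_cancel₀ hI ?_
  linear_combination h3

end Stone

/-! ### Partial trace and the Born rule -/

section Trace

variable {E F : Type*} [NormedAddCommGroup E] [InnerProductSpace ℂ E]
  [NormedAddCommGroup F] [InnerProductSpace ℂ F]

/-- `braL F e` is the adjoint of `f ↦ e ⊗ f`. -/
theorem inner_tmul_left (e : E) (f : F) (ψ : E ⊗[ℂ] F) :
    ⟪e ⊗ₜ[ℂ] f, ψ⟫_ℂ = ⟪f, braL F e ψ⟫_ℂ := by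
  induction ψ with
  | zero => simp
  | add x y hx hy => rw [inner_add_right, map_add, inner_add_right, hx, hy]
  | tmul u v => rw [TensorProduct.inner_tmul, braL_tmul, inner_smul_right]

theorem sum_tmul_braL {ι : Type*} [Fintype ι] (b : OrthonormalBasis ι ℂ E) (ψ : E ⊗[ℂ] F) :
    ∑ i, b i ⊗ₜ[ℂ] braL F (b i) ψ = ψ := by
  induction ψ with
  | zero => simp
  | add x y hx hy => simp only [map_add, TensorProduct.tmul_add, Finset.sum_add_distrib, hx, hy]
  | tmul u v =>
    conv_rhs => rw [← b.sum_repr' u, TensorProduct.sum_tmul]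
    simp [TensorProduct.smul_tmul']

theorem norm_sq_eq_sum_braL {ι : Type*} [Fintype ι] (b : OrthonormalBasis ι ℂ E)
    (ψ : E ⊗[ℂ] F) : ‖ψ‖ ^ 2 = ∑ i, ‖braL F (b i) ψ‖ ^ 2 := by
  have h : ⟪ψ, ψ⟫_ℂ = ∑ i, ⟪braL F (b i) ψ, braL F (b i) ψ⟫_ℂ := by
    conv_lhs => rw [← sum_tmul_braL b ψ, sum_inner]
    simp only [inner_tmul_left, sum_tmul_braL]
  rw [@norm_sq_eq_re_inner ℂ _ _ _ _ ψ, h, map_sum]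
  exact Finset.sum_congr rfl fun i _ => (norm_sq_eq_re_inner _).symm

theorem braL_lTensor (e : E) (Z : F →L[ℂ] F) (ψ : E ⊗[ℂ] F) :
    braL F e (Z.lTensor E ψ) = Z (braL F e ψ) := by
  induction ψ with
  | zero => simp
  | add x y hx hy => simp only [map_add, hx, hy]
  | tmul u v => rw [ContinuousLinearMap.lTensor_tmul, braL_tmul, braL_tmul, map_smul]

theorem partialTrace_rankOne [FiniteDimensional ℂ E] (ψ : E ⊗[ℂ] F) :
    partialTrace (InnerProductSpace.rankOne ℂ ψ ψ) =
      ∑ i, InnerProductSpace.rankOne ℂ (braL F (stdOrthonormalBasis ℂ E i) ψ)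
        (braL F (stdOrthonormalBasis ℂ E i) ψ) := by
  rw [partialTrace]
  refine Finset.sum_congr rfl fun i _ => ContinuousLinearMap.ext fun f => ?_
  simp only [ContinuousLinearMap.comp_apply, InnerProductSpace.rankOne_apply,
    TensorProduct.mkL_apply_apply, map_smul]
  congr 1
  rw [← inner_conj_symm, inner_tmul_left, inner_conj_symm]

theorem mapL_rankOne (u : E) (f : F) :
    TensorProduct.mapL (InnerProductSpace.rankOne ℂ u u) (InnerProductSpace.rankOne ℂ f f) =
      InnerProductSpace.rankOne ℂ (u ⊗ₜ[ℂ] f) (u ⊗ₜ[ℂ] f) := by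
  ext ψ
  induction ψ with
  | zero => simp
  | add x y hx hy => rw [map_add, map_add, hx, hy]
  | tmul v g =>
    rw [TensorProduct.mapL_tmul]
    simp only [InnerProductSpace.rankOne_apply, TensorProduct.inner_tmul,
      TensorProduct.smul_tmul_smul]

variable [CompleteSpace F]

/-- Parseval's identity in the Hilbert basis that defines `trace`. -/
theorem trace_sum_rankOne_mul {ι : Type*} [Fintype ι] (f : ι → F) {Z : F →L[ℂ] F}
    (hZ : IsStarProjection Z) :
    trace ((∑ i, InnerProductSpace.rankOne ℂ (f i) (f i)) * Z) =
      ((∑ i, ‖Z (f i)‖ ^ 2 : ℝ) : ℂ) := by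
  have hsa : ∀ x y : F, ⟪x, Z y⟫_ℂ = ⟪Z x, y⟫_ℂ := fun x y =>
    (hZ.isSelfAdjoint.isSymmetric x y).symm
  set b := (exists_hilbertBasis ℂ F).choose_spec.choose
  have h1 : ∀ i, HasSum (fun j => ⟪Z (f i), b j⟫_ℂ * ⟪b j, f i⟫_ℂ) (‖Z (f i)‖ ^ 2 : ℂ) := by
    intro i
    have h2 := b.hasSum_inner_mul_inner (Z (f i)) (f i)
    have h3 : ⟪Z (f i), f i⟫_ℂ = (‖Z (f i)‖ ^ 2 : ℂ) := by
      rw [← hsa]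
      nth_rw 1 [← hZ.isIdempotentElem.eq]
      rw [mul_apply_eq_comp, hsa, inner_self_eq_norm_sq_to_K]
      rfl
    rwa [h3] at h2
  have h4 := hasSum_sum fun i (_ : i ∈ Finset.univ) => h1 i
  simp only [trace, Complex.ofReal_sum, Complex.ofReal_pow]
  rw [← h4.tsum_eq]
  refine tsum_congr fun j => ?_
  simp only [mul_apply_eq_comp, sum_apply, InnerProductSpace.rankOne_apply, inner_sum,
    inner_smul_right, hsa]
  rfl

/-- The Born rule: the probability that the apparatus state gives the outcome `Z` is
`‖(1 ⊗ Z) U (q ⊗ Ω)‖²`. -/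
theorem trace_apparatusState_mul [FiniteDimensional ℂ E] (H : (E ⊗[ℂ] F) →ₗ.[ℂ] (E ⊗[ℂ] F))
    (hbar τ : ℝ) (q : E) (Ω : F) {Z : F →L[ℂ] F} (hZ : IsStarProjection Z) :
    (trace (apparatusState H hbar τ q Ω * Z)).re =
      ‖Z.lTensor E (timeEvolution H hbar τ (q ⊗ₜ[ℂ] Ω))‖ ^ 2 := by
  set ψ := timeEvolution H hbar τ (q ⊗ₜ[ℂ] Ω) with hψ
  have h1 : timeEvolution H hbar τ *
      TensorProduct.mapL (InnerProductSpace.rankOne ℂ q q) (InnerProductSpace.rankOne ℂ Ω Ω) *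
      star (timeEvolution H hbar τ) = InnerProductSpace.rankOne ℂ ψ ψ := by
    rw [mapL_rankOne]
    ext x
    simp only [mul_apply_eq_comp, InnerProductSpace.rankOne_apply, map_smul,
      ContinuousLinearMap.star_eq_adjoint, ContinuousLinearMap.adjoint_inner_right, hψ]
  rw [apparatusState, h1, partialTrace_rankOne, trace_sum_rankOne_mul _ hZ, Complex.ofReal_re,
    norm_sq_eq_sum_braL (stdOrthonormalBasis ℂ E)]
  simp only [braL_lTensor]

end Trace

/-! ### Drift of an observable under the time evolution -/

section Drift

variable {K : Type*} [NormedAddCommGroup K] [InnerProductSpace ℂ K]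

theorem norm_apply_le_opENorm {A : K →ₗ.[ℂ] K} (hA : opENorm A ≠ ∞) (φ : A.domain) :
    ‖A φ‖ ≤ (opENorm A).toReal * ‖(φ : K)‖ := by
  by_cases h0 : (φ : K) = 0
  · have : φ = 0 := Subtype.ext h0
    simp [this]
  have h1 : ‖A φ‖ₑ / ‖(φ : K)‖ₑ ≤ opENorm A := le_iSup₂_of_le φ h0 le_rfl
  rw [ENNReal.div_le_iff (by simpa using h0) (by simp)] at h1
  have h2 := ENNReal.toReal_mono (ENNReal.mul_ne_top hA (by simp)) h1
  simpa using h2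

/-- A bound on the commutator of an operator with `T`, in the sense of sesquilinear forms on its
graph `G`, survives passing to the closure of the operator. -/
theorem norm_inner_sub_le_of_mem_closure {T : K →L[ℂ] K} {G : Submodule ℂ (K × K)} {C : ℝ}
    (h : ∀ p ∈ G, ∀ q ∈ G, ‖⟪p.2, T q.1⟫_ℂ - ⟪T p.1, q.2⟫_ℂ‖ ≤ C * ‖p.1‖ * ‖q.1‖)
    {p q : K × K} (hp : p ∈ G.topologicalClosure) (hq : q ∈ G.topologicalClosure) :
    ‖⟪p.2, T q.1⟫_ℂ - ⟪T p.1, q.2⟫_ℂ‖ ≤ C * ‖p.1‖ * ‖q.1‖ := by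
  have hcl : IsClosed {r : (K × K) × (K × K) |
      ‖⟪r.1.2, T r.2.1⟫_ℂ - ⟪T r.1.1, r.2.2⟫_ℂ‖ ≤ C * ‖r.1.1‖ * ‖r.2.1‖} :=
    isClosed_le (by fun_prop) (by fun_prop)
  have hsub : (G : Set (K × K)) ×ˢ (G : Set (K × K)) ⊆ {r : (K × K) × (K × K) |
      ‖⟪r.1.2, T r.2.1⟫_ℂ - ⟪T r.1.1, r.2.2⟫_ℂ‖ ≤ C * ‖r.1.1‖ * ‖r.2.1‖} :=
    fun r hr => h r.1 hr.1 r.2 hr.2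
  have h1 := closure_minimal hsub hcl
  rw [closure_prod_eq] at h1
  exact h1 (Set.mk_mem_prod hp hq)

variable [CompleteSpace K]

/-- If `T x' ∈ D(H)`, `w = H T x'` and `y' = H x'`, then the form `⟪H x, T x'⟫ - ⟪T x, H x'⟫` is
`⟪x, [H, T] x'⟫`. -/
theorem norm_inner_sub_le_norm_mul_norm {H : K →ₗ.[ℂ] K} (hH : IsSelfAdjoint H)
    {T : K →L[ℂ] K} (hT : IsSelfAdjoint T) {x y x' y' w : K} (h : (x, y) ∈ H.graph)
    (h' : (T x', w) ∈ H.graph) :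
    ‖⟪y, T x'⟫_ℂ - ⟪T x, y'⟫_ℂ‖ ≤ ‖x‖ * ‖w - T y'‖ := by
  have hsym : ⟪T x, y'⟫_ℂ = ⟪x, T y'⟫_ℂ := hT.isSymmetric x y'
  rw [inner_graph_comm hH h h', hsym, ← inner_sub_right]
  exact norm_inner_le_norm _ _

/-- The derivative of `⟪U t ψ, T (U t χ)⟫` is `i / ħ` times the form of `[H, T]` at `U t ψ`,
`U t χ`; the mean value inequality gives the bound for `ψ`, `χ` in the domain, and continuity
extends it. -/
theorem IsUnitaryGroupOf.norm_inner_apply_sub_le {H : K →ₗ.[ℂ] K} (hH : IsSelfAdjoint H)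
    {hbar : ℝ} (hbar_pos : 0 < hbar) {U : ℝ → K →L[ℂ] K} (hU : IsUnitaryGroupOf H hbar U)
    {T : K →L[ℂ] K} (hT : IsSelfAdjoint T) {C : ℝ}
    (hC : ∀ p ∈ H.graph, ∀ q ∈ H.graph,
      ‖⟪p.2, T q.1⟫_ℂ - ⟪T p.1, q.2⟫_ℂ‖ ≤ C * ‖p.1‖ * ‖q.1‖)
    {τ : ℝ} (hτ : 0 ≤ τ) (ψ χ : K) :
    ‖⟪U τ ψ, T (U τ χ)⟫_ℂ - ⟪ψ, T χ⟫_ℂ‖ ≤ τ / hbar * C * (‖ψ‖ * ‖χ‖) := by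
  have hcl : IsClosed {p : K × K |
      ‖⟪U τ p.1, T (U τ p.2)⟫_ℂ - ⟪p.1, T p.2⟫_ℂ‖ ≤ τ / hbar * C * (‖p.1‖ * ‖p.2‖)} :=
    isClosed_le (by fun_prop) (by fun_prop)
  have hd := hH.dense_domain.prod hH.dense_domain
  have hsub : ((H.domain : Set K) ×ˢ (H.domain : Set K)) ⊆ {p : K × K |
      ‖⟪U τ p.1, T (U τ p.2)⟫_ℂ - ⟪p.1, T p.2⟫_ℂ‖ ≤ τ / hbar * C * (‖p.1‖ * ‖p.2‖)} := by
    rintro ⟨u, v⟩ ⟨hu, hv⟩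
    have hder : ∀ t, ∃ d, HasDerivAt (fun s => ⟪U s u, T (U s v)⟫_ℂ) d t ∧
        ‖d‖ ≤ hbar⁻¹ * (C * ‖u‖ * ‖v‖) := by
      intro t
      obtain ⟨hut, hu'⟩ := hU.hasDerivAt ⟨u, hu⟩ t
      obtain ⟨hvt, hv'⟩ := hU.hasDerivAt ⟨v, hv⟩ t
      have hTv := (T.restrictScalars ℝ).hasFDerivAt.comp_hasDerivAt t hv'
      refine ⟨_, hu'.inner ℂ hTv, ?_⟩
      have hsym : ∀ x y : K, ⟪T x, y⟫_ℂ = ⟪x, T y⟫_ℂ := fun x y => hT.isSymmetric x y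
      have h1 := hC _ (H.mem_graph ⟨_, hut⟩) _ (H.mem_graph ⟨_, hvt⟩)
      dsimp only at h1
      rw [ContinuousLinearMap.norm_map_of_mem_unitary (hU.unitary t),
        ContinuousLinearMap.norm_map_of_mem_unitary (hU.unitary t), hsym] at h1
      simp only [ContinuousLinearMap.coe_restrictScalars', map_smul, inner_smul_left,
        inner_smul_right, map_neg, map_div₀, Complex.conj_I, Complex.conj_ofReal]
      rw [show ∀ a b : ℂ, -(Complex.I / (hbar : ℂ)) * a + -(-Complex.I / (hbar : ℂ)) * b =
        Complex.I / (hbar : ℂ) * (b - a) by intros; ring]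
      rw [norm_mul, norm_div, Complex.norm_I, Complex.norm_real, Real.norm_of_nonneg hbar_pos.le,
        one_div]
      exact mul_le_mul_of_nonneg_left h1 (by positivity)
    choose d hd hdb using hder
    have h2 := Convex.norm_image_sub_le_of_norm_hasDerivWithin_le (s := Set.univ)
      (fun s _ => (hd s).hasDerivWithinAt) (fun s _ => hdb s)
      convex_univ (Set.mem_univ 0) (Set.mem_univ τ)
    rw [hU.map_zero, sub_zero, Real.norm_of_nonneg hτ] at h2
    refine h2.trans_eq ?_
    dsimp only
    ring
  have h3 := closure_minimal hsub hcl
  rw [hd.closure_eq] at h3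
  exact h3 (Set.mem_univ (ψ, χ))

end Drift

/-! ### The Hamiltonian of system and apparatus -/

section Tensor

variable {HS HA : Type*} [NormedAddCommGroup HS] [InnerProductSpace ℂ HS]
  [NormedAddCommGroup HA] [InnerProductSpace ℂ HA]

/-- The value of `1 ⊗ A` does not involve the chosen inverse of `E ⊗ D(A) → E ⊗ F`. -/
theorem idTensor_apply {A : HA →ₗ.[ℂ] HA} (w : HS ⊗[ℂ] A.domain) :
    idTensor HS A ⟨A.domain.subtype.lTensor HS w, w, rfl⟩ = A.toFun.lTensor HS w :=
  congrArg (A.toFun.lTensor HS) ((LinearEquiv.ofInjective (A.domain.subtype.lTensor HS)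
    (Module.Flat.lTensor_preserves_injective_linearMap _
      A.domain.injective_subtype)).symm_apply_apply w)

theorem mem_graph_idTensor_iff {A : HA →ₗ.[ℂ] HA} {x y : HS ⊗[ℂ] HA} :
    (x, y) ∈ (idTensor HS A).graph ↔
      ∃ w : HS ⊗[ℂ] A.domain, A.domain.subtype.lTensor HS w = x ∧ A.toFun.lTensor HS w = y := by
  rw [LinearPMap.mem_graph_iff]
  constructor
  · rintro ⟨⟨_, w, rfl⟩, rfl, rfl⟩
    exact ⟨w, rfl, (idTensor_apply w).symm⟩
  · rintro ⟨w, rfl, rfl⟩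
    exact ⟨⟨_, w, rfl⟩, rfl, idTensor_apply w⟩

/-- `T ⊗ 1` preserves the domain of `1 ⊗ A` and commutes with it there. -/
theorem rTensor_mem_graph_idTensor (T : HS →L[ℂ] HS) {A : HA →ₗ.[ℂ] HA} {x y : HS ⊗[ℂ] HA}
    (h : (x, y) ∈ (idTensor HS A).graph) :
    (T.rTensor HA x, T.rTensor HA y) ∈ (idTensor HS A).graph := by
  obtain ⟨w, rfl, rfl⟩ := mem_graph_idTensor_iff.1 h
  refine mem_graph_idTensor_iff.2 ⟨T.toLinearMap.rTensor A.domain w, ?_, ?_⟩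
  · simp only [ContinuousLinearMap.rTensor_apply, ← LinearMap.comp_apply,
      LinearMap.lTensor_comp_rTensor, LinearMap.rTensor_comp_lTensor]
  · simp only [ContinuousLinearMap.rTensor_apply, ← LinearMap.comp_apply,
      LinearMap.lTensor_comp_rTensor, LinearMap.rTensor_comp_lTensor]

theorem mem_graph_hamiltonianSum_iff {hamS : HS →L[ℂ] HS} {hamA : HA →ₗ.[ℂ] HA}
    {V : (HS ⊗[ℂ] HA) →ₗ.[ℂ] (HS ⊗[ℂ] HA)} {x y : HS ⊗[ℂ] HA} :
    (x, y) ∈ (hamiltonianSum hamS hamA V).graph ↔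
      ∃ (hx : x ∈ V.domain) (z : HS ⊗[ℂ] HA), (x, z) ∈ (idTensor HS hamA).graph ∧
        hamS.rTensor HA x + z + V ⟨x, hx⟩ = y := by
  rw [LinearPMap.mem_graph_iff]
  constructor
  · rintro ⟨⟨x, ⟨-, hx1⟩, hx2⟩, rfl, rfl⟩
    exact ⟨hx2, _, LinearPMap.mem_graph _ ⟨x, hx1⟩, rfl⟩
  · rintro ⟨hx, z, hz, rfl⟩
    obtain ⟨⟨x, hx1⟩, rfl, rfl⟩ := (LinearPMap.mem_graph_iff _).1 hz
    exact ⟨⟨x, ⟨trivial, hx1⟩, hx⟩, rfl, rfl⟩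

variable [FiniteDimensional ℂ HS] [CompleteSpace HA]

theorem isSelfAdjoint_rTensor [CompleteSpace HS] {T : HS →L[ℂ] HS} (hT : IsSelfAdjoint T) :
    IsSelfAdjoint (T.rTensor HA) := by
  rw [IsSelfAdjoint, ContinuousLinearMap.star_eq_adjoint, ContinuousLinearMap.adjoint_rTensor,
    ← ContinuousLinearMap.star_eq_adjoint, hT.star_eq]

/-- `H_S ⊗ 1` commutes with `H_S ⊗ 1 + 1 ⊗ H_A`, so only `[V, H_S ⊗ 1]` contributes to its drift. -/
theorem norm_inner_sub_le_of_mem_graph_totalHamiltonian {hamS : HS →L[ℂ] HS}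
    [CompleteSpace HS] (hhamS : IsSelfAdjoint hamS) {hamA : HA →ₗ.[ℂ] HA}
    {V : (HS ⊗[ℂ] HA) →ₗ.[ℂ] (HS ⊗[ℂ] HA)}
    (hVdom : ∀ φ ∈ V.domain, hamS.rTensor HA φ ∈ V.domain)
    (hH : IsSelfAdjoint (totalHamiltonian hamS hamA V))
    (hc : opENorm (commutator V (hamS.rTensor HA)) ≠ ∞)
    {p q : (HS ⊗[ℂ] HA) × (HS ⊗[ℂ] HA)} (hp : p ∈ (totalHamiltonian hamS hamA V).graph)
    (hq : q ∈ (totalHamiltonian hamS hamA V).graph) :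
    ‖⟪p.2, hamS.rTensor HA q.1⟫_ℂ - ⟪hamS.rTensor HA p.1, q.2⟫_ℂ‖ ≤
      (opENorm (commutator V (hamS.rTensor HA))).toReal * ‖p.1‖ * ‖q.1‖ := by
  have hle : hamiltonianSum hamS hamA V ≤ totalHamiltonian hamS hamA V :=
    LinearPMap.le_closure _
  have hcl : (hamiltonianSum hamS hamA V).IsClosable := hH.isClosed.isClosable.leIsClosable hle
  rw [totalHamiltonian, ← hcl.graph_closure_eq_closure_graph] at hp hq
  refine norm_inner_sub_le_of_mem_closure (fun p hp q hq => ?_) hp hq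
  obtain ⟨x, y⟩ := p
  obtain ⟨x', y'⟩ := q
  obtain ⟨hx', z, hz, rfl⟩ := mem_graph_hamiltonianSum_iff.1 hq
  set T := hamS.rTensor HA 
  have hT : IsSelfAdjoint T := isSelfAdjoint_rTensor hhamS
  have hTq : (T x', T (T x') + T z + V ⟨T x', hVdom _ hx'⟩) ∈
      (hamiltonianSum hamS hamA V).graph :=
    mem_graph_hamiltonianSum_iff.2 ⟨hVdom _ hx', T z, rTensor_mem_graph_idTensor hamS hz, rfl⟩
  have h2 : T (T x') + T z + V ⟨T x', hVdom _ hx'⟩ - T (T x' + z + V ⟨x', hx'⟩) =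
      commutator V T ⟨x', hx', hVdom _ hx'⟩ := by
    change _ = V ⟨T x', hVdom _ hx'⟩ - T (V ⟨x', hx'⟩)
    rw [map_add, map_add]
    abel
  calc _ ≤ ‖x‖ * ‖commutator V T ⟨x', hx', hVdom _ hx'⟩‖ := by
        rw [← h2]
        exact norm_inner_sub_le_norm_mul_norm hH hT (LinearPMap.le_graph_of_le hle hp)
          (LinearPMap.le_graph_of_le hle hTq)
    _ ≤ ‖x‖ * ((opENorm (commutator V T)).toReal * ‖x'‖) :=
      mul_le_mul_of_nonneg_left (norm_apply_le_opENorm hc _) (norm_nonneg _)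
    _ = _ := by ring

end Tensor

/-! ### Estimates for projections -/

section Estimate

variable {K : Type*} [NormedAddCommGroup K] [InnerProductSpace ℂ K] [CompleteSpace K]

/-- In the basis `q₀, q₁` the commutator `[Q, A]` has zero diagonal and the off-diagonal entries
`⟪q₁, A q₀⟫` and `-⟪q₀, A q₁⟫`, which have the same modulus. -/
theorem norm_commutator_le_of_finrank_eq_two (hdim : Module.finrank ℂ K = 2) {Q A : K →L[ℂ] K}
    (hQ : IsStarProjection Q) (hA : IsSelfAdjoint A) {q₀ q₁ : K} (hq₀ : ‖q₀‖ = 1)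
    (hq₁ : ‖q₁‖ = 1) (hQq₀ : Q q₀ = 0) (hQq₁ : Q q₁ = q₁) :
    ‖Q * A - A * Q‖ ≤ ‖⟪q₁, A q₀⟫_ℂ‖ := by
  have hQs : ∀ x y : K, ⟪Q x, y⟫_ℂ = ⟪x, Q y⟫_ℂ := fun x y => hQ.isSelfAdjoint.isSymmetric x y
  have hAs : ∀ x y : K, ⟪A x, y⟫_ℂ = ⟪x, A y⟫_ℂ := fun x y => hA.isSymmetric x y
  have horth : ⟪q₀, q₁⟫_ℂ = 0 := by rw [← hQq₁, ← hQs, hQq₀, inner_zero_left]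
  have hon : Orthonormal ℂ ![q₀, q₁] := by
    rw [orthonormal_iff_ite]
    intro i j
    fin_cases i <;> fin_cases j <;>
      simp [horth, inner_eq_zero_symm.1 horth, inner_self_eq_norm_sq_to_K, hq₀, hq₁]
  have : FiniteDimensional ℂ K := .of_finrank_pos (by omega)
  let b : OrthonormalBasis (Fin 2) ℂ K :=
    (basisOfOrthonormalOfCardEqFinrank hon (by simp [hdim])).toOrthonormalBasis (by simpa using hon)
  have hb0 : b 0 = q₀ := by simp [b]
  have hb1 : b 1 = q₁ := by simp [b]
  have hexp : ∀ x, ⟪q₀, x⟫_ℂ • q₀ + ⟪q₁, x⟫_ℂ • q₁ = x := fun x => by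
    simpa [Fin.sum_univ_two, hb0, hb1] using b.sum_repr' x
  have hsq : ∀ x, ‖⟪q₀, x⟫_ℂ‖ ^ 2 + ‖⟪q₁, x⟫_ℂ‖ ^ 2 = ‖x‖ ^ 2 := fun x => by
    simpa [Fin.sum_univ_two, hb0, hb1] using b.sum_sq_norm_inner_right x
  refine ContinuousLinearMap.opNorm_le_bound _ (norm_nonneg _) fun x => ?_
  refine (sq_le_sq₀ (norm_nonneg _) (by positivity)).1 (le_of_eq ?_)
  have hQx : Q x = ⟪q₁, x⟫_ℂ • q₁ := by
    conv_lhs => rw [← hexp x]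
    simp [hQq₀, hQq₁]
  have hxQ : x - Q x = ⟪q₀, x⟫_ℂ • q₀ := by
    rw [hQx, sub_eq_iff_eq_add, hexp]
  have h0 : ⟪q₀, (Q * A - A * Q) x⟫_ℂ = -(⟪q₁, x⟫_ℂ * ⟪A q₀, q₁⟫_ℂ) := by
    simp only [_root_.sub_apply, mul_apply_eq_comp, inner_sub_right]
    rw [← hQs, hQq₀, inner_zero_left, ← hAs, hQx, inner_smul_right, zero_sub]
  have h1 : ⟪q₁, (Q * A - A * Q) x⟫_ℂ = ⟪q₀, x⟫_ℂ * ⟪q₁, A q₀⟫_ℂ := by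
    simp only [_root_.sub_apply, mul_apply_eq_comp, inner_sub_right]
    rw [← hQs, hQq₁, ← inner_sub_right, ← map_sub, hxQ, map_smul, inner_smul_right]
  rw [← hsq, h0, h1, norm_neg, norm_mul, norm_mul, norm_inner_symm (A q₀), mul_pow, mul_pow,
    mul_pow, ← hsq x]
  ring

/-- If `T` commutes with the projection `R`, the matrix element of `T` between two states is small
as soon as `R` nearly distinguishes them. -/
theorem norm_inner_le_of_commute_projection {T R : K →L[ℂ] K} (hR : IsStarProjection R)
    (hTR : Commute T R) {φ₀ φ₁ : K} (h₀ : ‖φ₀‖ = 1) (h₁ : ‖φ₁‖ = 1) {P : ℝ}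
    (hP : P = (‖R φ₀‖ ^ 2 + ‖(1 - R) φ₁‖ ^ 2) / 2) :
    ‖⟪φ₁, T φ₀⟫_ℂ‖ ≤ ‖T‖ * (2 * Real.sqrt (P - P ^ 2)) := by
  have key : ∀ S : K →L[ℂ] K, IsStarProjection S → Commute T S →
      ‖⟪φ₁, T (S φ₀)⟫_ℂ‖ ≤ ‖T‖ * (‖S φ₁‖ * ‖S φ₀‖) := by
    intro S hS hTS
    have h1 : ⟪φ₁, T (S φ₀)⟫_ℂ = ⟪S φ₁, T (S φ₀)⟫_ℂ := by
      have h2 : S (T (S φ₀)) = T (S φ₀) := by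
        have h3 : S * (T * S) = T * S := by
          rw [← mul_assoc, ← hTS.eq, mul_assoc, hS.isIdempotentElem.eq]
        exact congrArg (fun L : K →L[ℂ] K => L φ₀) h3
      have h4 : ⟪S φ₁, T (S φ₀)⟫_ℂ = ⟪φ₁, S (T (S φ₀))⟫_ℂ := hS.isSelfAdjoint.isSymmetric _ _
      rw [h4, h2]
    rw [h1]
    calc _ ≤ ‖S φ₁‖ * ‖T (S φ₀)‖ := norm_inner_le_norm _ _
      _ ≤ ‖S φ₁‖ * (‖T‖ * ‖S φ₀‖) :=
        mul_le_mul_of_nonneg_left (T.le_opNorm _) (norm_nonneg _)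
      _ = _ := by ring
  have hpyth : ∀ φ : K, ‖φ‖ = 1 → ‖R φ‖ ^ 2 + ‖(1 - R) φ‖ ^ 2 = 1 := by
    intro φ hφ
    have horth : ⟪R φ, (1 - R) φ⟫_ℂ = 0 := by
      have h1 : ⟪R φ, (1 - R) φ⟫_ℂ = ⟪φ, R ((1 - R) φ)⟫_ℂ := hR.isSelfAdjoint.isSymmetric _ _
      have h2 : R * (1 - R) = 0 := by rw [mul_sub, mul_one, hR.isIdempotentElem.eq, sub_self]
      rw [h1, ← mul_apply_eq_comp, h2]
      simp
    have h3 := norm_add_sq_eq_norm_sq_add_norm_sq_of_inner_eq_zero (R φ) ((1 - R) φ) horth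
    have h4 : R φ + (1 - R) φ = φ := by simp
    rw [h4, hφ] at h3
    linarith
  have hsplit : ⟪φ₁, T φ₀⟫_ℂ = ⟪φ₁, T (R φ₀)⟫_ℂ + ⟪φ₁, T ((1 - R) φ₀)⟫_ℂ := by
    rw [← inner_add_right, ← map_add]; simp
  have h5 : ‖R φ₁‖ * ‖R φ₀‖ + ‖(1 - R) φ₁‖ * ‖(1 - R) φ₀‖ ≤ 2 * Real.sqrt (P - P ^ 2) := by
    have e0 := hpyth φ₀ h₀
    have e1 := hpyth φ₁ h₁
    rw [← div_le_iff₀' two_pos]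
    refine Real.le_sqrt_of_sq_le ?_
    -- Cauchy-Schwarz for the vectors `(‖R φ₀‖, ‖(1 - R) φ₁‖)` and `(‖R φ₁‖, ‖(1 - R) φ₀‖)`
    have hcs := sq_nonneg (‖R φ₀‖ * ‖(1 - R) φ₀‖ - ‖(1 - R) φ₁‖ * ‖R φ₁‖)
    have h6 : ‖R φ₀‖ ^ 2 + ‖(1 - R) φ₁‖ ^ 2 = 2 * P := by rw [hP]; ring
    have h7 : ‖R φ₁‖ ^ 2 + ‖(1 - R) φ₀‖ ^ 2 = 2 - 2 * P := by linarith
    have h8 : (‖R φ₀‖ ^ 2 + ‖(1 - R) φ₁‖ ^ 2) * (‖R φ₁‖ ^ 2 + ‖(1 - R) φ₀‖ ^ 2) =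
      2 * P * (2 - 2 * P) := by rw [h6, h7]
    nlinarith
  rw [hsplit]
  refine (norm_add_le _ _).trans ?_
  refine (add_le_add (key R hR hTR) (key (1 - R) hR.one_sub
    ((Commute.one_right T).sub_right hTR))).trans ?_
  rw [← mul_add]
  exact mul_le_mul_of_nonneg_left h5 (norm_nonneg _)

end Estimate

theorem isStarProjection_lTensor {E F : Type*} [NormedAddCommGroup E] [InnerProductSpace ℂ E]
    [FiniteDimensional ℂ E] [CompleteSpace E] [NormedAddCommGroup F] [InnerProductSpace ℂ F]
    [CompleteSpace F] {Z : F →L[ℂ] F} (hZ : IsStarProjection Z) :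
    IsStarProjection (Z.lTensor E) := by
  refine ⟨?_, ?_⟩
  · rw [IsIdempotentElem, ← ContinuousLinearMap.lTensor_mul, hZ.isIdempotentElem.eq]
  · rw [IsSelfAdjoint, ContinuousLinearMap.star_eq_adjoint,
      ContinuousLinearMap.adjoint_lTensor, ← ContinuousLinearMap.star_eq_adjoint,
      hZ.isSelfAdjoint.star_eq]

end QMeasure

end

/-! ### Commutators and the error probability -/

open QMeasure in
theorem corollary1 {HS HA : Type*}
    [NormedAddCommGroup HS] [InnerProductSpace ℂ HS] [FiniteDimensional ℂ HS] [CompleteSpace HS]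
    [NormedAddCommGroup HA] [InnerProductSpace ℂ HA] [CompleteSpace HA]
    (hdim : Module.finrank ℂ HS = 2)
    (hbar : ℝ) (hbar_pos : 0 < hbar) (τ : ℝ) (hτ : 0 ≤ τ)
    (Q hamS : HS →L[ℂ] HS) (hQ : IsStarProjection Q) (hhamS : IsSelfAdjoint hamS)
    (q₀ q₁ : HS) (hq₀ : ‖q₀‖ = 1) (hq₁ : ‖q₁‖ = 1) (hQq₀ : Q q₀ = 0) (hQq₁ : Q q₁ = q₁)
    (hamA : HA →ₗ.[ℂ] HA) (hhamA : IsSelfAdjoint hamA)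
    (V : (HS ⊗[ℂ] HA) →ₗ.[ℂ] (HS ⊗[ℂ] HA)) (hV : V.IsFormalAdjoint V)
    (hVdom : ∀ φ ∈ V.domain, hamS.rTensor HA φ ∈ V.domain)
    (hH : IsSelfAdjoint (QMeasure.totalHamiltonian hamS hamA V))
    (Ω : HA) (hΩ : ‖Ω‖ = 1)
    (Z : HA →L[ℂ] HA) (hZ : IsStarProjection Z)
    (P : ℝ)
    (hP : P = QMeasure.errorProb (QMeasure.totalHamiltonian hamS hamA V) hbar τ q₀ q₁ Ω Z) :
    ‖Q * hamS - hamS * Q‖ₑ ≤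
      2 * ‖hamS‖ₑ * ENNReal.ofReal (Real.sqrt (P - P ^ 2)) +
        ENNReal.ofReal (τ / hbar) *
          QMeasure.opENorm (QMeasure.commutator V (hamS.rTensor HA)) := by
  obtain ⟨U, hU⟩ := exists_isUnitaryGroupOf hH hbar_pos.ne'
  have hUeq := timeEvolution_eq hH hU
  set T := hamS.rTensor HA with hTdef
  have hT : IsSelfAdjoint T := isSelfAdjoint_rTensor hhamS
  have hR := isStarProjection_lTensor (E := HS) hZ
  have hTR : Commute T (Z.lTensor HS) := by
    rw [commute_iff_eq]
    exact (ContinuousLinearMap.rTensor_comp_lTensor hamS Z).trans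
      (ContinuousLinearMap.lTensor_comp_rTensor Z hamS).symm
  have hnorm : ∀ q : HS, ‖q‖ = 1 → ‖U τ (q ⊗ₜ[ℂ] Ω)‖ = 1 := fun q hq => by
    rw [ContinuousLinearMap.norm_map_of_mem_unitary (hU.unitary τ), TensorProduct.norm_tmul, hq,
      hΩ, one_mul]
  rw [errorProb, trace_apparatusState_mul _ _ _ _ _ hZ,
    trace_apparatusState_mul _ _ _ _ _ hZ.one_sub, hUeq, ContinuousLinearMap.lTensor_sub,
    ContinuousLinearMap.lTensor_one] at hP
  have hfinal := norm_inner_le_of_commute_projection hR hTR (hnorm q₀ hq₀) (hnorm q₁ hq₁) hP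
  have hinit : ⟪q₁ ⊗ₜ[ℂ] Ω, T (q₀ ⊗ₜ[ℂ] Ω)⟫_ℂ = ⟪q₁, hamS q₀⟫_ℂ := by
    rw [hTdef, ContinuousLinearMap.rTensor_tmul, TensorProduct.inner_tmul,
      inner_self_eq_norm_sq_to_K, hΩ]
    simp
  have hcomm := norm_commutator_le_of_finrank_eq_two hdim hQ hhamS hq₀ hq₁ hQq₀ hQq₁
  have hTle : ‖T‖ ≤ ‖hamS‖ := ContinuousLinearMap.norm_rTensor_le (G := HA) hamS
  -- it suffices to bound the change of the matrix element of `H_S ⊗ 1` by a real number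
  have main : ∀ d : ℝ, 0 ≤ d →
      ‖⟪U τ (q₁ ⊗ₜ[ℂ] Ω), T (U τ (q₀ ⊗ₜ[ℂ] Ω))⟫_ℂ - ⟪q₁ ⊗ₜ[ℂ] Ω, T (q₀ ⊗ₜ[ℂ] Ω)⟫_ℂ‖ ≤ d →
      ‖Q * hamS - hamS * Q‖ₑ ≤
        2 * ‖hamS‖ₑ * ENNReal.ofReal (Real.sqrt (P - P ^ 2)) + ENNReal.ofReal d := by
    intro d hd hdrift
    rw [hinit] at hdrift
    have h1 : ‖Q * hamS - hamS * Q‖ ≤ 2 * ‖hamS‖ * Real.sqrt (P - P ^ 2) + d := by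
      have h2 := norm_le_norm_add_norm_sub ⟪U τ (q₁ ⊗ₜ[ℂ] Ω), T (U τ (q₀ ⊗ₜ[ℂ] Ω))⟫_ℂ
        ⟪q₁, hamS q₀⟫_ℂ
      have h3 := mul_le_mul_of_nonneg_right hTle
        (by positivity : 0 ≤ 2 * Real.sqrt (P - P ^ 2))
      linarith
    have h4 := ENNReal.ofReal_le_ofReal h1
    rwa [ENNReal.ofReal_add (by positivity) hd, ENNReal.ofReal_mul (by positivity),
      ENNReal.ofReal_mul two_pos.le, ofReal_norm, ofReal_norm, ENNReal.ofReal_ofNat] at h4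
  rcases hτ.eq_or_lt with rfl | hτpos
  · have h := main 0 le_rfl (by simp [hU.map_zero])
    simpa using h
  by_cases hc : opENorm (commutator V T) = ∞
  · rw [hc, ENNReal.mul_top (by simpa using div_pos hτpos hbar_pos), add_top]
    exact le_top
  · have h := main (τ / hbar * (opENorm (commutator V T)).toReal) (by positivity) (by
      have h5 := hU.norm_inner_apply_sub_le hH hbar_pos hT
        (fun p hp q hq => norm_inner_sub_le_of_mem_graph_totalHamiltonian hhamS hVdom hH hc hp hq)
        hτ (q₁ ⊗ₜ[ℂ] Ω) (q₀ ⊗ₜ[ℂ] Ω)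
      rwa [TensorProduct.norm_tmul, TensorProduct.norm_tmul, hq₀, hq₁, hΩ, mul_one, mul_one,
        mul_one] at h5)
    rwa [ENNReal.ofReal_mul (by positivity), ENNReal.ofReal_toReal hc] at h
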